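/- Let $\mathbb{K}$ be a field, let $n\ge 2$ and $m\ge 1$ be integers, and put $t=n+m$. Consider the symmetric $t\times t$ matrix over the nonnegative integers $$H=[h_{i,j}]=\begin{bmatrix} A & D\\ D^{T} & C\end{bmatrix},$$ where $A$ is the $n\times n$ matrix with diagonal entries $\alpha_1,\dots,\alpha_n$ and all off-diagonal entries equal to $b$, $D=[d_{i,j}]$ is an $n\times m$ matrix, and $C$ is the symmetric $m\times m$ matrix with diagonal entries $\beta_1,\dots,\beta_m$ and off-diagonal entries $c_{i,j}=c_{j,i}$ ($i\ne j$). Assume the following conditions. (a) For all $i\in[n]$ and $j\in[m]$: $\alpha_i\ge b\ge 1$, $b\ge d_{i,j}\ge 0$, $\beta_j\ge 1$ and $\beta_j\ge d_{i,j}$. (b) For all $i\neq j$ in $[m]$: $\beta_i\ge c_{i,j}$ and $b\ge c_{i,j}$. (c) For all $i\ne j$ in $[n]$: $\alpha_i>b$ or $\alpha_j>b$. (d) For all $i\neq j$ in $[m]$: $\beta_i>c_{i,j}$ or $\beta_j>c_{i,j}$. (e) For all $i\in[n]$ and $j\in[m]$: $\alpha_i>d_{i,j}$ or $\beta_j>d_{i,j}$.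 (f) For each $j\in[m]$ there is some $i\in[n]$ with $d_{i,j}\ne b$. Let $R_t=\mathbb{K}[x_1,\dots,x_t]$ and let $\mathcal{J}_H$ be the monomial ideal $$\mathcal{J}_H=\left\langle x_k^{h_{k,k}},\ x_i^{h_{i,i}-h_{i,j}}x_j^{h_{j,j}-h_{i,j}} \;:\; 1\le k\le t,\ 1\le i<j\le t\right\rangle\subseteq R_t .$$ Suppose that $H$ is positive semidefinite. If $\dim_{\mathbb{K}}(R_t/\mathcal{J}_H)=\det H$, then for each $1\le l\le m$ we have $d_{r,l}=d_{s,l}$ for all $1\le r,s\le n$. -/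

import Mathlib

/-- The symmetric block matrix, with rows and columns indexed by `Fin n ⊕ Fin m`, whose upper left
block has diagonal `α 1, …, α n` and all off-diagonal entries equal to `b`, whose upper right block
is `d` (and lower left block its transpose), and whose lower right block has diagonal
`β 1, …, β m` and off-diagonal entries `c i j`. The diagonal values `c i i` are not used. -/
def cliqueBlockMatrix {n m : ℕ} (b : ℕ) (α : Fin n → ℕ) (β : Fin m → ℕ)
    (d : Matrix (Fin n) (Fin m) ℕ) (c : Matrix (Fin m) (Fin m) ℕ) :
    Matrix (Fin n ⊕ Fin m) (Fin n ⊕ Fin m) ℕ :=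
  Matrix.fromBlocks
    (Matrix.of fun i j => if i = j then α i else b) d
    d.transpose (Matrix.of fun i j => if i = j then β i else c i j)

/-- The monomial ideal attached to a symmetric matrix `H` of natural numbers whose diagonal entries
are at least as large as the other entries of their row: it is generated by the monomials
`x_t ^ H t t`, and `x_i ^ (H i i - H i j) * x_j ^ (H j j - H i j)` for the pairs `i ≠ j`
(by symmetry of `H`, each unordered pair gives one generator). -/
noncomputable def monomialIdealOf (K : Type*) [Field K] {ι : Type*} (H : Matrix ι ι ℕ) :
    Ideal (MvPolynomial ι K) :=
  Ideal.span
    ({p | ∃ t : ι, p = MvPolynomial.X t ^ H t t} ∪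
     {p | ∃ i j : ι, i ≠ j ∧
        p = MvPolynomial.X i ^ (H i i - H i j) * MvPolynomial.X j ^ (H j j - H i j)})

/-!
Write `H` for the block matrix and count the standard monomials `x ^ a` of its ideal in the
coordinates `y k = H k k - 1 - a k`: they become the vectors with `y k < H k k` for all `k` and
`max (y k) (y l) ≥ H k l` for all `k ≠ l` (`coStandard`). The dimension of the quotient is the number
`N H` of these vectors (`finrank_quotient_monomialIdealOf`).

Let `b` be an upper bound for the off-diagonal entries. As long as `H i i ≥ b`, both `N H` and
`det H` are affine functions of `H i i`, and in both cases the slope is the corresponding quantity for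
the principal submatrix omitting `i` (`card_coStandard_eq`, `det_toReal_eq`). Moreover, lowering `H i i`
in a positive definite matrix preserves positive semidefiniteness as long as the determinant remains
nonnegative (`posSemidef_sub_smul_single`). Lowering a diagonal entry to the largest off-diagonal
entry therefore gives `det H ≤ N H` for every positive semidefinite `H` whose diagonal entries
dominate their rows, by induction on the sum of the entries (`det_le_card_coStandard`).

Suppose that `N H = det H` with `H` positive definite, and that `H i j = b` is a maximal off-diagonal
entry. If `H j j = b`, then equality is inherited by the matrix `H'` obtained by lowering `H i i` to
`b`, so `H'` is still positive semidefinite; its form vanishes at `e_i - e_j`, so this vector lies in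
the kernel and the rows `i` and `j` agree outside the positions `i` and `j` (`row_eq_of_diag_eq`). In general, `H'` is either positive
definite, which reduces to the previous case, or has `N H' = det H' = 0`. The latter forces an index
`l` with `H l l = H i l = b`, and the rows `i` and `j` are both compared with the row `l`
(`row_eq_of_card_eq_det`). In the block matrix, any two indices of the first block are joined by the
maximal off-diagonal entry `b`, and the remaining inequalities make `N H` positive, so that `H` is
positive definite.
-/

/-! ### Counting standard monomials -/

open Classical in
/-- For a symmetric matrix `H` of natural numbers whose diagonal entries are at least the other
entries of their rows, the exponent vectors of the monomials outside `monomialIdealOf K H`, recorded in the complementary coordinates `y k = H k k - 1 - a k`, in which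
the conditions are `y k < H k k` and `max (y k) (y l) ≥ H k l`. -/
noncomputable def coStandard {ι : Type*} [Fintype ι] (H : Matrix ι ι ℕ) : Finset (ι → ℕ) :=
  (Fintype.piFinset fun k => Finset.range (H k k)).filter
    fun y : ι → ℕ => ∀ k l, k ≠ l → H k l ≤ y k ∨ H k l ≤ y l

/-- The matrix `H` with its `i`-th diagonal entry replaced by `v`. -/
def setDiag {ι : Type*} [DecidableEq ι] (H : Matrix ι ι ℕ) (i : ι) (v : ℕ) : Matrix ι ι ℕ :=
  Matrix.of fun k l => if k = i ∧ l = i then v else H k l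

/-- The matrix `H` with its `i`-th row and column replaced by those of the identity matrix. This
stands for the principal submatrix of `H` omitting `i`, without a change of index type. -/
def isolate {ι : Type*} [DecidableEq ι] (H : Matrix ι ι ℕ) (i : ι) : Matrix ι ι ℕ :=
  Matrix.of fun k l => if k = i ∨ l = i then (if k = l then 1 else 0) else H k l

section Count

variable {ι : Type*} [Fintype ι]

theorem mem_coStandard {H : Matrix ι ι ℕ} {y : ι → ℕ} :
    y ∈ coStandard H ↔
      (∀ k, y k < H k k) ∧ ∀ k l, k ≠ l → H k l ≤ y k ∨ H k l ≤ y l := by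
  simp [coStandard]

theorem card_coStandard_pos {H : Matrix ι ι ℕ} (h0 : ∀ k, 0 < H k k)
    (h : ∀ k l, k ≠ l → H k l < H k k ∨ H k l < H l l) : 0 < (coStandard H).card := by
  refine Finset.card_pos.2 ⟨fun k => H k k - 1, mem_coStandard.2 ⟨fun k => ?_, fun k l hkl => ?_⟩⟩
  · have := h0 k
    show H k k - 1 < H k k
    omega
  · have := h k l hkl
    show H k l ≤ H k k - 1 ∨ H k l ≤ H l l - 1
    omega

theorem card_coStandard_diagonal [DecidableEq ι] {H : Matrix ι ι ℕ} (h : ∀ k l, k ≠ l → H k l = 0) :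
    (coStandard H).card = ∏ k, H k k := by
  have : coStandard H = Fintype.piFinset fun k => Finset.range (H k k) := by
    ext y
    rw [mem_coStandard, Fintype.mem_piFinset]
    simp only [Finset.mem_range, and_iff_left_iff_imp]
    exact fun _ k l hkl => by simp [h k l hkl]
  simp [this]

/-- When `b` bounds the off-diagonal entries, the count is affine in the diagonal entry `H i i ≥ b`:
once `y i ≥ b`, all conditions involving `i` hold. -/
theorem card_coStandard_eq [DecidableEq ι] {H : Matrix ι ι ℕ} {b : ℕ} (i : ι)
    (hb : ∀ k l, k ≠ l → H k l ≤ b) (hi : b ≤ H i i) :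
    (coStandard H).card =
      (coStandard (setDiag H i b)).card + (H i i - b) * (coStandard (isolate H i)).card := by
  rw [← Finset.card_filter_add_card_filter_not (s := coStandard H) (fun y => y i < b)]
  congr 1
  · congr 1
    ext y
    simp only [Finset.mem_filter, mem_coStandard, setDiag, Matrix.of_apply, and_self]
    constructor
    · rintro ⟨⟨h1, h2⟩, h3⟩
      refine ⟨fun k => ?_, fun k l hkl => ?_⟩
      · split_ifs with h
        · rwa [h]
        · exact h1 k
      · rw [if_neg (by rintro ⟨rfl, rfl⟩; exact hkl rfl)]
        exact h2 k l hkl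
    · rintro ⟨h1, h2⟩
      have h3 : y i < b := by simpa using h1 i
      refine ⟨⟨fun k => ?_, fun k l hkl => ?_⟩, h3⟩
      · by_cases h : k = i
        · subst h; omega
        · simpa [h] using h1 k
      · have := h2 k l hkl
        rwa [if_neg (by rintro ⟨rfl, rfl⟩; exact hkl rfl)] at this
  · rw [← Nat.card_Ico, ← Finset.card_product]
    refine Finset.card_nbij' (fun y => (y i, Function.update y i 0))
      (fun p => Function.update p.2 i p.1) ?_ ?_ ?_ ?_
    · intro y hy
      simp only [Finset.coe_filter, Set.mem_ofPred_eq, mem_coStandard, not_lt] at hy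
      obtain ⟨⟨h1, h2⟩, h3⟩ := hy
      simp only [Finset.coe_product, Set.mem_prod, Finset.mem_coe, Finset.mem_Ico, mem_coStandard,
        isolate, Matrix.of_apply]
      refine ⟨⟨h3, h1 i⟩, fun k => ?_, fun k l hkl => ?_⟩
      · by_cases h : k = i
        · subst h; simp
        · simpa [h] using h1 k
      · by_cases h : k = i
        · simp [h, h ▸ hkl]
        · by_cases h' : l = i
          · simp [h', h]
          · simpa [h, h'] using h2 k l hkl
    · rintro ⟨v, z⟩ hz
      simp only [Finset.coe_product, Set.mem_prod, Finset.mem_coe, Finset.mem_Ico, mem_coStandard,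
        isolate, Matrix.of_apply] at hz
      obtain ⟨⟨h3, h4⟩, h1, h2⟩ := hz
      simp only [Finset.coe_filter, Set.mem_ofPred_eq, mem_coStandard, not_lt]
      refine ⟨⟨fun k => ?_, fun k l hkl => ?_⟩, by simpa using h3⟩
      · by_cases h : k = i
        · subst h; simpa using h4
        · simpa [h] using h1 k
      · by_cases h : k = i
        · subst h
          left
          simpa using (hb _ _ hkl).trans h3
        · by_cases h' : l = i
          · subst h'
            right
            simpa using (hb _ _ hkl).trans h3
          · simpa [h, h'] using h2 k l hkl
    · intro y _
      simp
    · rintro ⟨v, z⟩ hz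
      simp only [Finset.coe_product, Set.mem_prod, Finset.mem_coe, mem_coStandard,
        isolate, Matrix.of_apply] at hz
      have h0 : z i = 0 := by simpa using hz.2.1 i
      simp [← h0]

end Count

/-! ### The dimension of the quotient -/

section Quotient

variable {ι : Type*}

theorem monomialIdealOf_eq_span (K : Type*) [Field K] (H : Matrix ι ι ℕ) :
    monomialIdealOf K H = Ideal.span ((fun s => MvPolynomial.monomial s (1 : K)) ''
      ({s | ∃ t, s = Finsupp.single t (H t t)} ∪
       {s | ∃ i j, i ≠ j ∧
          s = Finsupp.single i (H i i - H i j) + Finsupp.single j (H j j - H i j)})) := by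
  rw [monomialIdealOf, Set.image_union]
  congr 2
  · ext p
    simp [MvPolynomial.X_pow_eq_monomial, eq_comm]
  · ext p
    simp only [MvPolynomial.X_pow_eq_monomial, MvPolynomial.monomial_mul, Set.mem_ofPred_eq,
      Set.mem_image, mul_one]
    constructor
    · rintro ⟨i, j, h, rfl⟩
      exact ⟨_, ⟨i, j, h, rfl⟩, rfl⟩
    · rintro ⟨_, ⟨i, j, h, rfl⟩, rfl⟩
      exact ⟨i, j, h, rfl⟩

theorem mem_monomialIdealOf_iff {K : Type*} [Field K] {H : Matrix ι ι ℕ}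
    {p : MvPolynomial ι K} :
    p ∈ monomialIdealOf K H ↔ ∀ a ∈ p.support, (∃ t, H t t ≤ a t) ∨
      ∃ i j, i ≠ j ∧ H i i - H i j ≤ a i ∧ H j j - H i j ≤ a j := by
  rw [monomialIdealOf_eq_span, MvPolynomial.mem_ideal_span_monomial_image]
  refine forall₂_congr fun a _ => ?_
  constructor
  · rintro ⟨s, ⟨t, rfl⟩ | ⟨i, j, hij, rfl⟩, hs⟩
    · exact Or.inl ⟨t, by simpa using hs t⟩
    · refine Or.inr ⟨i, j, hij, ?_, ?_⟩
      · simpa [hij] using hs i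
      · simpa [hij.symm, Finsupp.single_apply, hij] using hs j
  · rintro (⟨t, ht⟩ | ⟨i, j, hij, h1, h2⟩)
    · exact ⟨_, Or.inl ⟨t, rfl⟩, by simpa using ht⟩
    · refine ⟨_, Or.inr ⟨i, j, hij, rfl⟩, fun k => ?_⟩
      by_cases hki : k = i
      · subst hki; simpa [Finsupp.single_apply, hij.symm] using h1
      · by_cases hkj : k = j
        · subst hkj; simpa [Finsupp.single_apply, hij] using h2
        · simp [Ne.symm hki, Ne.symm hkj]

/-- The monomials outside a monomial ideal form a basis of the quotient. -/
theorem finrank_quotient_monomialIdealOf [Fintype ι] (K : Type*) [Field K] (H : Matrix ι ι ℕ)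
    (hdiag : ∀ k l, H k l ≤ H k k) (hsymm : ∀ k l, H k l = H l k) :
    Module.finrank K (MvPolynomial ι K ⧸ monomialIdealOf K H) = (coStandard H).card := by
  classical
  let e : (ι → ℕ) → (ι →₀ ℕ) := fun y => Finsupp.equivFunOnFinite.symm fun k => H k k - 1 - y k
  have he : ∀ y k, e y k = H k k - 1 - y k := fun y k => rfl
  have hinj : ∀ y ∈ coStandard H, ∀ z ∈ coStandard H, e y = e z → y = z := by
    intro y hy z hz h
    funext k
    have h1 := (mem_coStandard.1 hy).1 k
    have h2 := (mem_coStandard.1 hz).1 k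
    have h3 := DFunLike.congr_fun h k
    rw [he, he] at h3
    omega
  let φ : MvPolynomial ι K →ₗ[K] (coStandard H → K) :=
    LinearMap.pi fun y => MvPolynomial.lcoeff K (e y)
  have hφ : ∀ p y, φ p y = p.coeff (e y) := fun p y => rfl
  have hker : LinearMap.ker φ = (monomialIdealOf K H).restrictScalars K := by
    ext p
    rw [LinearMap.mem_ker, Submodule.restrictScalars_mem, mem_monomialIdealOf_iff]
    constructor
    · intro hp a ha
      by_contra! hcon
      have hmem : (fun k => H k k - 1 - a k) ∈ coStandard H := by
        refine mem_coStandard.2 ⟨fun k => ?_, fun k l hkl => ?_⟩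
        · have := hcon.1 k
          show H k k - 1 - a k < H k k
          omega
        · have h1 := hcon.1 k
          have h2 := hcon.1 l
          have h3 := hcon.2 k l hkl
          show H k l ≤ H k k - 1 - a k ∨ H k l ≤ H l l - 1 - a l
          omega
      have h1 := congr_fun hp ⟨_, hmem⟩
      rw [hφ] at h1
      refine MvPolynomial.mem_support_iff.1 ha ?_
      convert h1 using 2
      · ext k
        have := hcon.1 k
        rw [he]
        show a k = H k k - 1 - (H k k - 1 - a k)
        omega
      · rfl
    · intro hp
      funext y
      rw [hφ]
      by_contra hne
      obtain ⟨h1, h2⟩ := mem_coStandard.1 y.2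
      rcases hp _ (MvPolynomial.mem_support_iff.2 hne) with ⟨t, ht⟩ | ⟨i, j, hij, hi, hj⟩
      · have := h1 t
        rw [he] at ht
        omega
      · have h3 := h1 i
        have h4 := h1 j
        have h5 := h2 i j hij
        have h6 := hdiag i j
        have h7 := hdiag j i
        have h8 := hsymm i j
        rw [he] at hi hj
        omega
  have hsurj : LinearMap.range φ = ⊤ := by
    refine LinearMap.range_eq_top.2 fun f =>
      ⟨∑ y : coStandard H, MvPolynomial.monomial (e y.1) (f y), ?_⟩
    funext z
    rw [hφ, MvPolynomial.coeff_sum, Finset.sum_eq_single z]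
    · simp
    · intro y _ hyz
      rw [MvPolynomial.coeff_monomial, if_neg]
      exact fun h => hyz (Subtype.ext (hinj _ y.2 _ z.2 h))
    · simp
  rw [← (Submodule.Quotient.restrictScalarsEquiv K (monomialIdealOf K H)).finrank_eq, ← hker,
    (φ.quotKerEquivRange).finrank_eq, hsurj, finrank_top, Module.finrank_fintype_fun_eq_card,
    Fintype.card_coe]

end Quotient

/-! ### Determinants and positivity under a change of one diagonal entry -/

section Determinant

open Matrix

variable {ι : Type*}

/-- The real matrix with the entries of `H`. -/
abbrev toReal (H : Matrix ι ι ℕ) : Matrix ι ι ℝ := H.map (fun k : ℕ => (k : ℝ))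

theorem toReal_setDiag [DecidableEq ι] {H : Matrix ι ι ℕ} {i : ι} {b : ℕ} (hi : b ≤ H i i) :
    toReal (setDiag H i b) = toReal H - ((H i i - b : ℕ) : ℝ) • Matrix.single i i 1 := by
  ext k l
  by_cases h : k = i ∧ l = i
  · obtain ⟨rfl, rfl⟩ := h
    simp [setDiag, Nat.cast_sub hi]
  · have h' : ¬ (i = k ∧ i = l) := fun h' => h ⟨h'.1.symm, h'.2.symm⟩
    simp [setDiag, h, h']

theorem mul_self_lt_of_posDef {H : Matrix ι ι ℕ} (hH : (toReal H).PosDef)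
    (hsymm : ∀ k l, H k l = H l k) {i j : ι} (hij : i ≠ j) :
    H i j * H i j < H i i * H j j := by
  have h := (hH.submatrix (e := ![i, j]) (by
    intro a c
    fin_cases a <;> fin_cases c <;> simp [hij, hij.symm])).det_pos
  rw [Matrix.det_fin_two] at h
  simp [hsymm j i] at h
  exact_mod_cast h

theorem lt_or_lt_of_posDef {H : Matrix ι ι ℕ} (hH : (toReal H).PosDef)
    (hsymm : ∀ k l, H k l = H l k) {i j : ι} (hij : i ≠ j) :
    H i j < H i i ∨ H i j < H j j := by
  by_contra! h
  exact absurd (Nat.mul_le_mul h.1 h.2) (not_le.2 (mul_self_lt_of_posDef hH hsymm hij))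

variable [Fintype ι] [DecidableEq ι]

theorem det_sub_smul_single (A : Matrix ι ι ℝ) (i : ι) (e : ℝ) :
    (A - e • Matrix.single i i 1).det = A.det - e * A.adjugate i i := by
  have h : A - e • Matrix.single i i 1 = A.updateRow i (A i + (-e) • Pi.single i 1) := by
    ext k l
    by_cases hk : k = i
    · subst hk
      by_cases hl : l = k
      · subst hl; simp [sub_eq_add_neg]
      · simp [hl, Ne.symm hl]
    · simp [hk, Ne.symm hk]
  rw [h, Matrix.det_updateRow_add, Matrix.det_updateRow_smul, Matrix.updateRow_eq_self,
    Matrix.adjugate_apply]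
  ring

theorem det_isolate (H : Matrix ι ι ℕ) (i : ι) :
    (toReal (isolate H i)).det = (toReal H).adjugate i i := by
  set B := (toReal H).updateRow i (Pi.single i 1) with hB
  have h1 : toReal (isolate H i) = (Bᵀ.updateRow i (Pi.single i 1))ᵀ := by
    ext k l
    by_cases hl : l = i
    · subst hl
      by_cases hk : k = l
      · subst hk; simp [isolate]
      · simp [isolate, hk]
    · by_cases hk : k = i
      · subst hk
        simp [isolate, hl, Ne.symm hl, hB]
      · simp [isolate, hl, hk, hB]
  rw [h1, Matrix.det_transpose, ← Matrix.adjugate_apply, ← Matrix.adjugate_transpose,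
    Matrix.transpose_apply, Matrix.adjugate_apply, Matrix.adjugate_apply, hB,
    Matrix.updateRow_idem]

/-- The determinant satisfies the same recursion as the count in `card_coStandard_eq`. -/
theorem det_toReal_eq {H : Matrix ι ι ℕ} {b : ℕ} {i : ι} (hi : b ≤ H i i) :
    (toReal H).det = (toReal (setDiag H i b)).det +
      ((H i i - b : ℕ) : ℝ) * (toReal (isolate H i)).det := by
  rw [toReal_setDiag hi, det_sub_smul_single, det_isolate]
  ring

/-- Lowering one diagonal entry of a positive definite matrix keeps it positive semidefinite as
long as the determinant stays nonnegative: by Cauchy-Schwarz for the form of `A`, applied to `x` and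
the `i`-th column of the adjugate, `xᵀ A x ≥ (det A / adj A i i) (x i)²`. -/
theorem posSemidef_sub_smul_single {A : Matrix ι ι ℝ} (hA : A.PosDef) (i : ι) {e : ℝ}
    (hdet : 0 ≤ (A - e • Matrix.single i i 1).det) :
    (A - e • Matrix.single i i 1).PosSemidef := by
  rw [det_sub_smul_single] at hdet
  set D := A.det with hD
  have hD0 : 0 < D := hA.det_pos
  set p := A.adjugate i i with hp
  let u : ι → ℝ := fun k => A.adjugate k i
  have hAu : A *ᵥ u = Pi.single i D := by
    ext k
    have := congr_fun (congr_fun A.mul_adjugate k) i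
    rw [Matrix.mul_apply] at this
    rw [Matrix.mulVec, dotProduct, this]
    by_cases hk : k = i
    · subst hk; simp [hD]
    · simp [hk]
  have hsymm : ∀ x z : ι → ℝ, x ⬝ᵥ (A *ᵥ z) = z ⬝ᵥ (A *ᵥ x) := fun x z => by
    have hT : Aᵀ = A := by simpa using hA.isHermitian.eq
    rw [Matrix.dotProduct_mulVec, ← Matrix.mulVec_transpose, hT, dotProduct_comm]
  have hu0 : u ≠ 0 := by
    intro h
    rw [h, Matrix.mulVec_zero] at hAu
    have := congr_fun hAu i
    simp at this
    exact hD0.ne this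
  have hp0 : 0 < p := by
    have := hA.dotProduct_mulVec_pos hu0
    rw [hAu] at this
    have h2 : 0 < p * D := by simpa [u] using this
    exact pos_of_mul_pos_left h2 hD0.le
  refine Matrix.PosSemidef.of_dotProduct_mulVec_nonneg ?_ fun x => ?_
  · refine hA.isHermitian.sub ?_
    ext k l
    simp [Matrix.single_apply, and_comm]
  · have hsingle : x ⬝ᵥ ((e • Matrix.single i i (1 : ℝ)) *ᵥ x) = e * x i ^ 2 := by
      rw [Matrix.smul_mulVec, dotProduct_smul, Matrix.single_mulVec]
      simp [Function.update, dotProduct, sq]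
    rw [star_trivial, Matrix.sub_mulVec, dotProduct_sub, hsingle]
    -- Nonnegativity of the form of `A` at its minimizer along the line `x + ℝ u`.
    have h1 := hA.posSemidef.dotProduct_mulVec_nonneg (x - (x i / p) • u)
    rw [star_trivial, Matrix.mulVec_sub, Matrix.mulVec_smul, sub_dotProduct, dotProduct_sub,
      dotProduct_sub, smul_dotProduct, smul_dotProduct, hsymm u x, dotProduct_smul,
      dotProduct_smul, hAu, dotProduct_single, dotProduct_single] at h1
    have hui : u i = p := rfl
    rw [hui] at h1
    simp only [smul_eq_mul] at h1
    have h2 : x i / p * (x i / p * (p * D)) = x i / p * (x i * D) := by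
      field_simp
    have h3 : e * x i ^ 2 ≤ x i / p * (x i * D) := by
      have : x i / p * (x i * D) - e * x i ^ 2 = x i ^ 2 * (D - e * p) / p := by
        field_simp
      have h4 : 0 ≤ x i ^ 2 * (D - e * p) / p := by positivity
      linarith
    linarith

theorem posSemidef_isolate {H : Matrix ι ι ℕ} (hH : (toReal H).PosSemidef) (i : ι) :
    (toReal (isolate H i)).PosSemidef := by
  let δ : ι → ℝ := fun k => if k = i then 0 else 1
  have h : toReal (isolate H i) =
      (Matrix.diagonal δ)ᴴ * toReal H * Matrix.diagonal δ + Matrix.diagonal fun k => 1 - δ k := by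
    ext k l
    rw [Matrix.diagonal_conjTranspose, Matrix.add_apply, Matrix.mul_diagonal,
      Matrix.diagonal_mul, Matrix.diagonal_apply]
    by_cases hk : k = i <;> by_cases hl : l = i <;> by_cases hkl : k = l <;>
      simp_all [isolate, δ]
  rw [h]
  refine (hH.conjTranspose_mul_mul_same _).add (Matrix.PosSemidef.diagonal fun k => ?_)
  by_cases hk : k = i <;> simp [δ, hk]

end Determinant

/-! ### The inequality between determinant and count -/

section Inequality

variable {ι : Type*} [DecidableEq ι]

theorem setDiag_self (H : Matrix ι ι ℕ) (i : ι) (v : ℕ) : setDiag H i v i i = v := by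
  simp [setDiag]

theorem setDiag_of_ne (H : Matrix ι ι ℕ) {i : ι} (v : ℕ) {k l : ι} (hkl : k ≠ l) :
    setDiag H i v k l = H k l := by
  simp only [setDiag, Matrix.of_apply]
  rw [if_neg]
  rintro ⟨rfl, rfl⟩
  exact hkl rfl

theorem setDiag_diag_of_ne (H : Matrix ι ι ℕ) {i : ι} (v : ℕ) {k : ι} (hk : k ≠ i) :
    setDiag H i v k k = H k k := by
  simp [setDiag, hk]

theorem setDiag_symm {H : Matrix ι ι ℕ} (hsymm : ∀ k l, H k l = H l k) (i : ι) (v : ℕ) (k l : ι) :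
    setDiag H i v k l = setDiag H i v l k := by
  simp [setDiag, hsymm k l, and_comm]

theorem setDiag_le_diag {H : Matrix ι ι ℕ} (hdiag : ∀ k l, H k l ≤ H k k) {i : ι} {b : ℕ}
    (hb : ∀ k l, k ≠ l → H k l ≤ b) (k l : ι) : setDiag H i b k l ≤ setDiag H i b k k := by
  by_cases hkl : k = l
  · rw [hkl]
  · rw [setDiag_of_ne H b hkl]
    by_cases hk : k = i
    · rw [hk, setDiag_self, ← hk]
      exact hb k l hkl
    · rw [setDiag_diag_of_ne H b hk]
      exact hdiag k l

theorem isolate_symm {H : Matrix ι ι ℕ} (hsymm : ∀ k l, H k l = H l k) (i k l : ι) :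
    isolate H i k l = isolate H i l k := by
  simp [isolate, hsymm k l, or_comm, eq_comm]

theorem isolate_le_diag {H : Matrix ι ι ℕ} (hdiag : ∀ k l, H k l ≤ H k k) (i k l : ι) :
    isolate H i k l ≤ isolate H i k k := by
  by_cases hk : k = i
  · simp only [isolate, hk, Matrix.of_apply, true_or, if_true]
    split_ifs <;> simp
  · by_cases hl : l = i
    · simp [isolate, hk, hl]
    · simpa [isolate, hk, hl] using hdiag k l

variable [Fintype ι]

theorem sum_setDiag_lt {H : Matrix ι ι ℕ} {i : ι} {b : ℕ} (hi : b < H i i) :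
    ∑ p : ι × ι, setDiag H i b p.1 p.2 < ∑ p : ι × ι, H p.1 p.2 := by
  refine Finset.sum_lt_sum (fun p _ => ?_) ⟨(i, i), Finset.mem_univ _, by simpa [setDiag] using hi⟩
  simp only [setDiag, Matrix.of_apply]
  split_ifs with h
  · rw [h.1, h.2]
    exact hi.le
  · exact le_rfl

theorem sum_isolate_lt {H : Matrix ι ι ℕ} {i j : ι} (hij : i ≠ j) (h0 : 0 < H i j)
    (hi : 0 < H i i) : ∑ p : ι × ι, isolate H i p.1 p.2 < ∑ p : ι × ι, H p.1 p.2 := by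
  refine Finset.sum_lt_sum (fun p _ => ?_)
    ⟨(i, j), Finset.mem_univ _, by simpa [isolate, hij] using h0⟩
  obtain ⟨k, l⟩ := p
  simp only [isolate, Matrix.of_apply]
  split_ifs with h h'
  · subst h'
    rw [or_self_iff] at h
    rw [h]
    exact hi
  · exact Nat.zero_le _
  · exact le_rfl

theorem exists_max_offDiag {H : Matrix ι ι ℕ} (h : ¬ ∀ k l, k ≠ l → H k l = 0) :
    ∃ i j, i ≠ j ∧ 0 < H i j ∧ ∀ k l, k ≠ l → H k l ≤ H i j := by
  push Not at h
  obtain ⟨k, l, hkl, h0⟩ := h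
  obtain ⟨⟨i, j⟩, hij, hmax⟩ := Finset.exists_max_image
    (Finset.univ.filter fun p : ι × ι => p.1 ≠ p.2) (fun p => H p.1 p.2) ⟨(k, l), by simpa using hkl⟩
  have hmax' : ∀ k l, k ≠ l → H k l ≤ H i j := fun k l h => hmax (k, l) (by simpa using h)
  exact ⟨i, j, by simpa using hij, (Nat.pos_of_ne_zero h0).trans_le (hmax' k l hkl), hmax'⟩

/-- The determinant bounds the count from below. Let `b` be the largest off-diagonal entry, in
position `(i, j)`, with `H i i > b`. Both sides are affine in `H i i` with slopes given by
`isolate H i`, so it suffices to compare them for the two smaller matrices `isolate H i` and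
`setDiag H i b`; the latter may fail to be positive semidefinite, but only when its determinant is
negative. -/
theorem det_le_card_coStandard {H : Matrix ι ι ℕ} (hsymm : ∀ k l, H k l = H l k)
    (hdiag : ∀ k l, H k l ≤ H k k) (hH : (toReal H).PosSemidef) :
    (toReal H).det ≤ ((coStandard H).card : ℝ) := by
  induction hs : ∑ p : ι × ι, H p.1 p.2 using Nat.strong_induction_on generalizing H with
  | _ s ih =>
    subst hs
    rcases le_or_gt (toReal H).det 0 with hdet | hdet
    · exact hdet.trans (Nat.cast_nonneg _)
    have hPD := hH.posDef_iff_det_ne_zero.2 hdet.ne'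
    by_cases hD : ∀ k l, k ≠ l → H k l = 0
    · have : toReal H = Matrix.diagonal fun k => (H k k : ℝ) := by
        ext k l
        by_cases hkl : k = l
        · simp [hkl]
        · simp [hkl, hD k l hkl]
      rw [this, Matrix.det_diagonal, card_coStandard_diagonal hD]
      push_cast
      exact le_rfl
    · have : ∃ i j, i ≠ j ∧ 0 < H i j ∧ (∀ k l, k ≠ l → H k l ≤ H i j) ∧ H i j < H i i := by
        obtain ⟨i, j, hij, h0, hmax⟩ := exists_max_offDiag hD
        rcases lt_or_lt_of_posDef hPD hsymm hij with h | h
        · exact ⟨i, j, hij, h0, hmax, h⟩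
        · rw [hsymm i j] at h h0 hmax
          exact ⟨j, i, hij.symm, h0, hmax, h⟩
      obtain ⟨i, j, hij, h0, hmax, hi⟩ := this
      have h1 := ih _ (sum_isolate_lt hij h0 (h0.trans hi)) (isolate_symm hsymm i)
        (isolate_le_diag hdiag i) (posSemidef_isolate hH i) rfl
      have h2 : (toReal (setDiag H i (H i j))).det ≤ (coStandard (setDiag H i (H i j))).card := by
        rcases le_or_gt (toReal (setDiag H i (H i j))).det 0 with h | h
        · exact h.trans (Nat.cast_nonneg _)
        · refine ih _ (sum_setDiag_lt hi) (setDiag_symm hsymm _ _) (setDiag_le_diag hdiag hmax) ?_ rfl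
          rw [toReal_setDiag hi.le] at h ⊢
          exact posSemidef_sub_smul_single hPD i h.le
      rw [det_toReal_eq hi.le, card_coStandard_eq i hmax hi.le]
      push_cast
      gcongr

end Inequality

/-! ### Rigidity in the case of equality -/

section Equality

open Matrix

variable {ι : Type*} [Fintype ι] [DecidableEq ι]

/-- If the determinant equals the count, then the determinant of `setDiag H i b` is at least the
count for that matrix, hence nonnegative, and positive semidefiniteness persists. -/
theorem posSemidef_setDiag_of_card_eq_det {H : Matrix ι ι ℕ} {b : ℕ}
    (hsymm : ∀ k l, H k l = H l k) (hdiag : ∀ k l, H k l ≤ H k k) (hH : (toReal H).PosDef)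
    (heq : ((coStandard H).card : ℝ) = (toReal H).det) (hmax : ∀ k l, k ≠ l → H k l ≤ b) {i : ι}
    (hi : b ≤ H i i) :
    (toReal (setDiag H i b)).PosSemidef ∧
      ((coStandard (setDiag H i b)).card : ℝ) = (toReal (setDiag H i b)).det := by
  have h1 := det_le_card_coStandard (isolate_symm hsymm i) (isolate_le_diag hdiag i)
    (posSemidef_isolate hH.posSemidef i)
  have h2 : ((coStandard (setDiag H i b)).card : ℝ) ≤ (toReal (setDiag H i b)).det := by
    rw [det_toReal_eq hi, card_coStandard_eq i hmax hi] at heq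
    push_cast at heq
    have := mul_le_mul_of_nonneg_left h1 (Nat.cast_nonneg (α := ℝ) (H i i - b))
    linarith
  have h3 : (toReal (setDiag H i b)).PosSemidef := by
    have h4 := (Nat.cast_nonneg (α := ℝ) _).trans h2
    rw [toReal_setDiag hi] at h4 ⊢
    exact posSemidef_sub_smul_single hH i h4
  exact ⟨h3, h2.antisymm
    (det_le_card_coStandard (setDiag_symm hsymm _ _) (setDiag_le_diag hdiag hmax) h3)⟩

/-- The case of `row_eq_of_card_eq_det` in which one of the two diagonal entries is `b`. After
lowering the other one to `b` as well, the positive semidefinite form vanishes at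
`e_i - e_j`, which is therefore in the kernel. -/
theorem row_eq_of_diag_eq {H : Matrix ι ι ℕ} {b : ℕ}
    (hsymm : ∀ k l, H k l = H l k) (hdiag : ∀ k l, H k l ≤ H k k) (hH : (toReal H).PosDef)
    (heq : ((coStandard H).card : ℝ) = (toReal H).det) (hmax : ∀ k l, k ≠ l → H k l ≤ b) {i j : ι}
    (hij : i ≠ j) (hb : H i j = b) (hj : H j j = b) {k : ι} (hki : k ≠ i) (hkj : k ≠ j) :
    H i k = H j k := by
  have hP := (posSemidef_setDiag_of_card_eq_det hsymm hdiag hH heq hmax (i := i)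
    (hb ▸ hdiag i j)).1
  set B := setDiag H i b with hB
  have hmul : ∀ r, (toReal B *ᵥ (Pi.single i 1 - Pi.single j 1)) r = (B r i : ℝ) - B r j := by
    intro r
    rw [Matrix.mulVec_sub]
    simp
  have hBij : B i j = b := by rw [hB, setDiag_of_ne H b hij, hb]
  have hBji : B j i = b := by rw [hB, setDiag_symm hsymm, ← hB, hBij]
  have hBii : B i i = b := setDiag_self H i b
  have hBjj : B j j = b := by rw [hB, setDiag_diag_of_ne H b hij.symm, hj]
  have hzero := (hP.dotProduct_mulVec_zero_iff (Pi.single i 1 - Pi.single j 1)).1 (by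
    rw [star_trivial, sub_dotProduct, single_dotProduct, single_dotProduct, hmul, hmul,
      hBij, hBji, hBii, hBjj]
    ring)
  have hk := congr_fun hzero k
  rw [hmul, Pi.zero_apply, sub_eq_zero, Nat.cast_inj, hB, setDiag_of_ne H b hki,
    setDiag_of_ne H b hkj] at hk
  rw [hsymm i k, hsymm j k, hk]

/-- If the determinant equals the count, two indices joined by a maximal off-diagonal entry have the
same remaining entries. -/
theorem row_eq_of_card_eq_det {H : Matrix ι ι ℕ} {b : ℕ}
    (hsymm : ∀ k l, H k l = H l k) (hdiag : ∀ k l, H k l ≤ H k k) (hH : (toReal H).PosDef)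
    (heq : ((coStandard H).card : ℝ) = (toReal H).det) (hmax : ∀ k l, k ≠ l → H k l ≤ b)
    (hb0 : 0 < b) {i j : ι} (hij : i ≠ j) (hb : H i j = b) {k : ι} (hki : k ≠ i) (hkj : k ≠ j) :
    H i k = H j k := by
  have hib : b ≤ H i i := hb ▸ hdiag i j
  obtain ⟨hP, heqB⟩ := posSemidef_setDiag_of_card_eq_det hsymm hdiag hH heq hmax hib
  by_cases hdet : (toReal (setDiag H i b)).det = 0
  · -- No vector satisfies the conditions for `setDiag H i b`, so some `l` has `H l l = H i l = b`.
    have hempty : ¬ 0 < (coStandard (setDiag H i b)).card := by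
      rw [hdet] at heqB
      simp [Nat.cast_eq_zero.1 heqB]
    have hl : ∃ l, i ≠ l ∧ H i l = b ∧ H l l = b := by
      by_contra! hcon
      refine hempty (card_coStandard_pos (fun r => ?_) fun r s hrs => ?_)
      · by_cases hr : r = i
        · rw [hr, setDiag_self]
          exact hb0
        · rw [setDiag_diag_of_ne H b hr]
          simpa using hH.diag_pos (i := r)
      · have key : ∀ s, i ≠ s → H i s < b ∨ H i s < H s s := fun s his => by
          have h1 := hcon s his
          have h2 := hmax i s his
          have h3 := hdiag s i
          rw [hsymm s i] at h3
          by_contra! h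
          exact h1 (le_antisymm h2 h.1) (by omega)
        rw [setDiag_of_ne H b hrs]
        by_cases hr : r = i
        · subst hr
          rw [setDiag_self, setDiag_diag_of_ne H b hrs.symm]
          exact key s hrs
        · by_cases hs : s = i
          · subst hs
            rw [setDiag_self, setDiag_diag_of_ne H b hr, hsymm r s]
            exact (key r (Ne.symm hr)).symm
          · rw [setDiag_diag_of_ne H b hr, setDiag_diag_of_ne H b hs]
            exact lt_or_lt_of_posDef hH hsymm hrs
    obtain ⟨l, hil, hbl, hll⟩ := hl
    have case_l : ∀ r, r ≠ i → r ≠ l → H i r = H l r := fun r hri hrl =>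
      row_eq_of_diag_eq hsymm hdiag hH heq hmax hil hbl hll hri hrl
    by_cases hlj : l = j
    · exact hlj ▸ case_l k hki (hlj ▸ hkj)
    · have hjl : H j l = b := by rw [hsymm j l, ← case_l j hij.symm (Ne.symm hlj), hb]
      by_cases hkl : k = l
      · rw [hkl, hbl, hjl]
      · rw [case_l k hki hkl,
          row_eq_of_diag_eq hsymm hdiag hH heq hmax (Ne.symm hlj) hjl hll hkj hkl]
  · have h := row_eq_of_diag_eq (setDiag_symm hsymm i b) (setDiag_le_diag hdiag hmax)
      (hP.posDef_iff_det_ne_zero.2 hdet) heqB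
      (fun r s hrs => (setDiag_of_ne H b hrs).symm ▸ hmax r s hrs) hij.symm
      (by rw [setDiag_of_ne H b hij.symm, hsymm, hb]) (setDiag_self H i b) hkj hki
    rw [setDiag_of_ne H b (Ne.symm hkj), setDiag_of_ne H b (Ne.symm hki)] at h
    exact h.symm

end Equality

/-! ### Clique block matrices -/

theorem mainTheorem2 {K : Type*} [Field K] {n m : ℕ} (hn : 2 ≤ n) (hm : 1 ≤ m)
    (b : ℕ) (α : Fin n → ℕ) (β : Fin m → ℕ)
    (d : Matrix (Fin n) (Fin m) ℕ) (c : Matrix (Fin m) (Fin m) ℕ)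
    (hc : ∀ i j, c i j = c j i)
    (h_a : ∀ i j, b ≤ α i ∧ 1 ≤ b ∧ d i j ≤ b ∧ 1 ≤ β j ∧ d i j ≤ β j)
    (h_b : ∀ i j, i ≠ j → c i j ≤ β i ∧ c i j ≤ b)
    (h_c : ∀ i j, i ≠ j → b < α i ∨ b < α j)
    (h_d : ∀ i j, i ≠ j → c i j < β i ∨ c i j < β j)
    (h_e : ∀ i j, d i j < α i ∨ d i j < β j)
    (h_f : ∀ j, ∃ i, b ≠ d i j)
    (hpos : ((cliqueBlockMatrix b α β d c).map (fun k : ℕ => (k : ℝ))).PosSemidef)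
    (hdim : (Module.finrank K (MvPolynomial (Fin n ⊕ Fin m) K ⧸
        monomialIdealOf K (cliqueBlockMatrix b α β d c)) : ℝ) =
      ((cliqueBlockMatrix b α β d c).map (fun k : ℕ => (k : ℝ))).det) :
    ∀ (l : Fin m) (r s : Fin n), d r l = d s l := by
  intro l r s
  by_cases hrs : r = s
  · rw [hrs]
  set H := cliqueBlockMatrix b α β d c with hH
  have h11 : ∀ i j, H (Sum.inl i) (Sum.inl j) = if i = j then α i else b := fun _ _ => rfl
  have h12 : ∀ i j, H (Sum.inl i) (Sum.inr j) = d i j := fun _ _ => rfl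
  have h21 : ∀ i j, H (Sum.inr j) (Sum.inl i) = d i j := fun _ _ => rfl
  have h22 : ∀ i j, H (Sum.inr i) (Sum.inr j) = if i = j then β i else c i j := fun _ _ => rfl
  have hsymm : ∀ k l, H k l = H l k := by
    rintro (i | i) (j | j)
    · simp only [h11]
      by_cases h : i = j
      · simp [h]
      · simp [h, Ne.symm h]
    · rw [h12, h21]
    · rw [h12, h21]
    · simp only [h22]
      by_cases h : i = j
      · simp [h]
      · simp [h, Ne.symm h, hc i j]
  have hdiag : ∀ k l, H k l ≤ H k k := by
    rintro (i | i) (j | j)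
    · simp only [h11, if_true]
      split_ifs
      · exact le_rfl
      · exact (h_a i l).1
    · simp only [h11, h12, if_true]
      exact (h_a i j).2.2.1.trans (h_a i j).1
    · simp only [h21, h22, if_true]
      exact (h_a j i).2.2.2.2
    · simp only [h22, if_true]
      split_ifs with h
      · exact le_rfl
      · exact (h_b i j h).1
  have hmax : ∀ k l, k ≠ l → H k l ≤ b := by
    rintro (i | i) (j | j) hij
    · rw [h11, if_neg (by simpa using hij)]
    · rw [h12]
      exact (h_a i j).2.2.1
    · rw [h21]
      exact (h_a j i).2.2.1
    · have hij' : i ≠ j := by simpa using hij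
      rw [h22, if_neg hij']
      exact (h_b i j hij').2
  have hcard : 0 < (coStandard H).card := by
    refine card_coStandard_pos ?_ ?_
    · rintro (i | i)
      · rw [h11, if_pos rfl]
        exact (h_a i l).2.1.trans (h_a i l).1
      · rw [h22, if_pos rfl]
        exact (h_a r i).2.2.2.1
    · rintro (i | i) (j | j) hij
      · have hij' : i ≠ j := by simpa using hij
        simp only [h11, if_true, if_neg hij']
        exact h_c i j hij'
      · simp only [h11, h12, h22, if_true]
        exact h_e i j
      · simp only [h11, h21, h22, if_true]
        exact (h_e j i).symm
      · have hij' : i ≠ j := by simpa using hij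
        simp only [h22, if_true, if_neg hij']
        exact h_d i j hij'
  rw [finrank_quotient_monomialIdealOf K H hdiag hsymm] at hdim
  have hPD : (toReal H).PosDef := hpos.posDef_iff_det_ne_zero.2 (by
    rw [← hdim]
    exact_mod_cast hcard.ne')
  have h := row_eq_of_card_eq_det hsymm hdiag hPD hdim hmax (h_a r l).2.1
    (i := Sum.inl r) (j := Sum.inl s) (k := Sum.inr l) (by simpa using hrs)
    (by rw [h11, if_neg hrs]) (by simp) (by simp)
  rwa [h12, h12] at h
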